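/- Let $\mathsf{FI}$ be the category of finite sets and injections. An $\mathsf{FI}$-module is a functor $M\colon \mathsf{FI}\to\mathsf{Ab}$, and an $\mathsf{FI}^{\mathrm{op}}$-module is a functor $\mathsf{FI}^{\mathrm{op}}\to\mathsf{Ab}$; write $[n]=\{1,\dots,n\}$. We use the following definitions. (1) An $\mathsf{FI}$-module $M$ is presented in finite degree if, for some $k\in\mathbb N$, it is isomorphic to the cokernel of a map $\bigoplus_{j\in J}\mathbb Z\mathsf{FI}([b_j],-)\to\bigoplus_{i\in I}\mathbb Z\mathsf{FI}([a_i],-)$ with all $a_i,b_j\le k$, where the index sets $I$ and $J$ may be infinite. (2) $\Sigma M=M([1]\sqcup -)$ is the shift of $M$, and $M\to\Sigma M$ is the map induced by the inclusions $S\subseteq[1]\sqcup S$. An $\mathsf{FI}$-module $M$ presented in finite degree has polynomial degree $\le 0$ if it is eventually constant, that is, there is an $N$ such that every injection $S\to T$ with $|S|\ge N$ induces an isomorphism $M_S\to M_T$; for $d\ge 1$, it has polynomial degree $\le d$ if $\operatorname{coker}(M\to\Sigma M)$ has polynomial degree $\le d-1$. (3) For $\ell\in\mathbb N$, $\Xi(\ell)$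 is the $\mathsf{FI}^{\mathrm{op}}$-module $\Xi(\ell)_S=H_0(X_S,A_S;\mathbb Z)$, where $X_S=\mathrm{Emb}(S,[\ell]\sqcup\mathbb R)$ is the space of injections $\phi\colon S\to[\ell]\sqcup\mathbb R$ with the topology of pointwise convergence, $A_S\subseteq X_S$ is the subspace of those $\phi$ with $[\ell]\not\subseteq\operatorname{im}\phi$, $H_0$ is relative singular homology, and injections act by precomposition. (4) For an $\mathsf{FI}$-module $M$ and an $\mathsf{FI}^{\mathrm{op}}$-module $N$, the tensor product $M\otimes_{\mathsf{FI}}N$ is the quotient of $\bigoplus_{n\in\mathbb N}M_{[n]}\otimes_{\mathbb Z}N_{[n]}$ by the subgroup generated by all $M_f(y)\otimes x-y\otimes N_f(x)$, for injections $f\colon[m]\to[n]$, $y\in M_{[m]}$ and $x\in N_{[n]}$. Corollary. Let $M$ be an $\mathsf{FI}$-module presented in finite degree, let $d\in\mathbb N$, and assume that $M$ has polynomial degree $\le d$. Then the tail invariant $M\otimes_{\mathsf{FI}}\Xi(\ell)$ is zero for every integer $\ell>d$. -/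

import Mathlib

open CategoryTheory CategoryTheory.Limits
open scoped TensorProduct

universe u v

/-- The category `FI`: objects are finite sets, morphisms are injections. -/
structure FI : Type 1 where
  carrier : Type
  [finite : Finite carrier]

namespace FI

attribute [instance] FI.finite

instance : Category FI where
  Hom S T := S.carrier ↪ T.carrier
  id S := Function.Embedding.refl S.carrier
  comp f g := Function.Embedding.trans f g

/-- The underlying injection of a morphism of `FI`. -/
def emb {S T : FI} (f : S ⟶ T) : S.carrier ↪ T.carrier := f

/-- The standard finite set with `n` elements. -/
def std (n : ℕ) : FI := ⟨Fin n⟩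

/-- The functor `[1] ⊔ - : FI ⥤ FI`. -/
def addPoint : FI ⥤ FI where
  obj S := ⟨Fin 1 ⊕ S.carrier⟩
  map f := Function.Embedding.sumMap (Function.Embedding.refl (Fin 1)) (emb f)
  map_id S := by
    apply Function.Embedding.ext
    rintro (x | x) <;> rfl
  map_comp f g := by
    apply Function.Embedding.ext
    rintro (x | x) <;> rfl

/-- The natural inclusion `S ⊆ [1] ⊔ S`. -/
def inclAddPoint : 𝟭 FI ⟶ addPoint where
  app S := (Function.Embedding.inr : S.carrier ↪ Fin 1 ⊕ S.carrier)
  naturality S T f := by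
    apply Function.Embedding.ext
    intro x
    rfl

end FI

/-- `FI`-modules: functors from `FI` to abelian groups. -/
abbrev FIMod := FI ⥤ AddCommGrpCat.{u}

/-- `FIᵒᵖ`-modules. -/
abbrev FIopMod := FIᵒᵖ ⥤ AddCommGrpCat.{v}

noncomputable section

namespace FIMod

/-- The shift `ΣM = M([1] ⊔ -)`. -/
def shift (M : FIMod.{u}) : FIMod.{u} := FI.addPoint ⋙ M

/-- The natural map `M ⟶ ΣM` induced by the inclusions `S ⊆ [1] ⊔ S`. -/
def toShift (M : FIMod.{u}) : M ⟶ shift M where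
  app S := M.map (FI.inclAddPoint.app S)
  naturality S T f := by
    have h := FI.inclAddPoint.naturality f
    change M.map f ≫ M.map (FI.inclAddPoint.app T) =
      M.map (FI.inclAddPoint.app S) ≫ M.map (FI.addPoint.map f)
    rw [← M.map_comp, ← M.map_comp, ← h]
    rfl

/-- The disjoint union of the sets `FI([a i], T)` over a family `a` of degrees, functorially
in the finite set `T`. -/
def basis {I : Type u} (a : I → ℕ) : FI ⥤ Type u where
  obj T := Σ i : I, (FI.std (a i) ⟶ T)
  map f := TypeCat.ofHom fun x => ⟨x.1, x.2 ≫ f⟩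

/-- The direct sum `⨁ i, ℤFI([a i], -)`: the free `FI`-module with one generator in degree `a i`
for every `i`. -/
def free {I : Type u} (a : I → ℕ) : FIMod.{u} := basis a ⋙ AddCommGrpCat.free

/-- `M` is presented in degrees `≤ d`: it is the cokernel of a map between free `FI`-modules on
(possibly infinitely many) generators of degrees `≤ d`. -/
def PresentedInDegreesLE (d : ℕ) (M : FIMod.{u}) : Prop :=
  ∃ (I J : Type u) (a : I → ℕ) (b : J → ℕ) (φ : free b ⟶ free a),
    (∀ i, a i ≤ d) ∧ (∀ j, b j ≤ d) ∧ Nonempty (cokernel φ ≅ M)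

/-- `M` is presented in finite degree. -/
def PresentedInFiniteDegree (M : FIMod.{u}) : Prop :=
  ∃ d : ℕ, PresentedInDegreesLE d M

/-- `M` is eventually constant: injections between sufficiently large finite sets act by
isomorphisms. -/
def EventuallyConstant (M : FIMod.{u}) : Prop :=
  ∃ N : ℕ, ∀ (S T : FI) (f : S ⟶ T), N ≤ Nat.card S.carrier → IsIso (M.map f)

/-- `M` has polynomial degree `≤ d`. -/
def PolynomialDegreeLE : ℕ → FIMod.{u} → Prop
  | 0, M => EventuallyConstant M
  | d + 1, M => PolynomialDegreeLE d (cokernel (toShift M))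

/-- The relations `m f ⊗ x - m ⊗ f x` of the functor tensor product over `FI`, where `f` runs
over the injections `[m] → [n]`. -/
def tensorRelations (M : FIMod.{u}) (N : FIopMod.{v}) :
    AddSubgroup (DirectSum ℕ fun n => M.obj (FI.std n) ⊗[ℤ] N.obj (Opposite.op (FI.std n))) :=
  AddSubgroup.closure
    {r | ∃ (m n : ℕ) (f : FI.std m ⟶ FI.std n) (y : M.obj (FI.std m))
        (x : N.obj (Opposite.op (FI.std n))),
      r = DirectSum.of (fun n => M.obj (FI.std n) ⊗[ℤ] N.obj (Opposite.op (FI.std n))) n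
            ((M.map f).hom y ⊗ₜ[ℤ] x) -
          DirectSum.of (fun n => M.obj (FI.std n) ⊗[ℤ] N.obj (Opposite.op (FI.std n))) m
            (y ⊗ₜ[ℤ] (N.map f.op).hom x)}

/-- The functor tensor product `M ⊗_FI N`, an abelian group; it is computed over the skeleton of
`FI` on the sets `[n]`. -/
abbrev tensor (M : FIMod.{u}) (N : FIopMod.{v}) : Type (max u v) :=
  (DirectSum ℕ fun n => M.obj (FI.std n) ⊗[ℤ] N.obj (Opposite.op (FI.std n))) ⧸
    tensorRelations M N

end FIMod

namespace TailInvariant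

/-- The space `X_S = Emb(S, [ℓ] ⊔ ℝ)` of injections of the finite set `S`, with the topology of
pointwise convergence. -/
abbrev X (ℓ : ℕ) (S : FI) : Type :=
  {φ : S.carrier → Fin ℓ ⊕ ℝ // Function.Injective φ}

/-- The subspace `A_S` of those `φ` whose image does not contain `[ℓ]`. -/
abbrev A (ℓ : ℕ) (S : FI) : Type :=
  {φ : X ℓ S // ¬ Set.range (Sum.inl : Fin ℓ → Fin ℓ ⊕ ℝ) ⊆ Set.range φ.1}

/-- Precomposition with an injection, on `X`. -/
def restrictX (ℓ : ℕ) {S T : FI} (f : S ⟶ T) (φ : X ℓ T) : X ℓ S :=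
  ⟨φ.1 ∘ FI.emb f, φ.2.comp (FI.emb f).injective⟩

/-- Precomposition with an injection, on `A`. -/
def restrictA (ℓ : ℕ) {S T : FI} (f : S ⟶ T) (φ : A ℓ T) : A ℓ S :=
  ⟨restrictX ℓ f φ.1, fun h => φ.2 (h.trans
    (Set.range_comp_subset_range (FI.emb f) φ.1.1))⟩

theorem continuous_restrictX (ℓ : ℕ) {S T : FI} (f : S ⟶ T) :
    Continuous (restrictX ℓ f) := by
  refine Continuous.subtype_mk (f := fun φ : X ℓ T => φ.1 ∘ FI.emb f) ?_ _
  exact continuous_pi fun s => (continuous_apply (FI.emb f s)).comp continuous_subtype_val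

theorem continuous_restrictA (ℓ : ℕ) {S T : FI} (f : S ⟶ T) :
    Continuous (restrictA ℓ f) :=
  Continuous.subtype_mk ((continuous_restrictX ℓ f).comp continuous_subtype_val) _

/-- The pair of spaces `(X_S, A_S)`, recorded as the inclusion `A_S ⟶ X_S`, functorial in `S`
by precomposition. -/
def pair (ℓ : ℕ) : FIᵒᵖ ⥤ Arrow TopCat.{0} where
  obj S := Arrow.mk (TopCat.ofHom
    (⟨Subtype.val, continuous_subtype_val⟩ : C(A ℓ S.unop, X ℓ S.unop)))
  map f := Arrow.homMk (TopCat.ofHom ⟨restrictA ℓ f.unop, continuous_restrictA ℓ f.unop⟩)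
    (TopCat.ofHom ⟨restrictX ℓ f.unop, continuous_restrictX ℓ f.unop⟩) rfl
  map_id _ := rfl
  map_comp _ _ := rfl

/-- The relative singular chain complex `C(X) / C(A)` of a pair `A ⟶ X`, with integer
coefficients. -/
def relativeChains : Arrow TopCat.{0} ⥤ ChainComplex AddCommGrpCat.{0} ℕ :=
  ((AlgebraicTopology.singularChainComplexFunctor AddCommGrpCat.{0}).obj
    (AddCommGrpCat.of ℤ)).mapArrow ⋙ coker (ChainComplex AddCommGrpCat.{0} ℕ)

/-- The relative singular homology `H_n(X, A; ℤ)`. -/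
def relativeHomology (n : ℕ) : Arrow TopCat.{0} ⥤ AddCommGrpCat.{0} :=
  relativeChains ⋙ HomologicalComplex.homologyFunctor AddCommGrpCat.{0} (ComplexShape.down ℕ) n

/-- The `FIᵒᵖ`-module `Ξ(ℓ)`, with `Ξ(ℓ)_S = H_0(X_S, A_S)`. -/
def Xi (ℓ : ℕ) : FIopMod.{0} := pair ℓ ⋙ relativeHomology 0

end TailInvariant

end

/-!
Polynomial degree `≤ d` forces the cross effects of `M` at more than `d` points of any large `T` to
vanish: splitting a point off `T` identifies the cross effects of `M` with those of `coker(M →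
ΣM)`, and iterating down to an eventually constant module leaves a single point. In other words
`M_T` is generated by the images of the injections whose image misses one of the chosen points.

On the other side, `Ξ(ℓ)_T` is generated by the classes of injections `φ : T → [ℓ] ⊔ ℝ`, and such a
class is zero unless `φ` hits all of `[ℓ]`. Restricting it along an injection that misses one of
the `ℓ` points of `φ⁻¹[ℓ]` kills it, so in `M ⊗_FI Ξ(ℓ)` each generator of `M_T` moves across the
tensor sign and gives zero. Since `[ℓ] ⊔ ℝ` is infinite, every `φ` extends to a larger set, so it
is enough to treat large `T`.
-/

noncomputable section

theorem exists_embedding_trans_eq {α β γ : Type*} [Finite β] [Infinite γ] (f : α ↪ β)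
    (φ : α ↪ γ) : ∃ ψ : β ↪ γ, f.trans ψ = φ := by
  classical
  have : Finite α := Finite.of_injective f f.injective
  have : Infinite ↥(Set.range φ)ᶜ := (Set.finite_range φ).infinite_compl.to_subtype
  let θ : ↥(Set.range f)ᶜ ↪ ↥(Set.range φ)ᶜ :=
    (Finite.equivFin _).toEmbedding.trans (Fin.valEmbedding.trans (Infinite.natEmbedding _))
  let e : α ⊕ ↥(Set.range f)ᶜ ≃ β :=
    ((Equiv.ofInjective f f.injective).sumCongr (Equiv.refl _)).trans
      (Equiv.Set.sumCompl (Set.range f))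
  let ψ : α ⊕ ↥(Set.range f)ᶜ ↪ γ :=
    ⟨Sum.elim φ (Subtype.val ∘ θ), φ.injective.sumElim (Subtype.val_injective.comp θ.injective)
      fun a b h => (θ b).2 ⟨a, h⟩⟩
  refine ⟨e.symm.toEmbedding.trans ψ, Function.Embedding.ext fun a => ?_⟩
  have : e.symm (f a) = Sum.inl a := e.symm_apply_eq.2 rfl
  change ψ (e.symm (f a)) = φ a
  rw [this]
  rfl

theorem ncard_le_ncard_preimage_inr_add_one {α β : Type*} [Subsingleton α] (A : Set (α ⊕ β)) :
    A.ncard ≤ (Sum.inr ⁻¹' A).ncard + 1 := by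
  calc A.ncard
      = (Sum.inl '' (Sum.inl ⁻¹' A) ∪ Sum.inr '' (Sum.inr ⁻¹' A)).ncard := by
        rw [Set.image_preimage_inl_union_image_preimage_inr]
    _ ≤ (Sum.inl '' (Sum.inl ⁻¹' A)).ncard + (Sum.inr '' (Sum.inr ⁻¹' A)).ncard :=
        Set.ncard_union_le _ _
    _ = (Sum.inl ⁻¹' A).ncard + (Sum.inr ⁻¹' A).ncard := by
        rw [Set.ncard_image_of_injective _ Sum.inl_injective,
          Set.ncard_image_of_injective _ Sum.inr_injective]
    _ ≤ (Sum.inr ⁻¹' A).ncard + 1 := by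
        rw [add_comm]
        exact Nat.add_le_add_left (Set.ncard_le_one_of_subsingleton _) _

section AddCommGrpValued

variable {C : Type*} [Category* C] {F G : C ⥤ AddCommGrpCat.{u}}

theorem map_hom_surjective_of_isIso {X Y : C} (f : X ⟶ Y) [IsIso (F.map f)] :
    Function.Surjective (F.map f).hom :=
  (AddCommGrpCat.epi_iff_surjective _).1 inferInstance

theorem cokernel_π_app_surjective (f : F ⟶ G) (X : C) :
    Function.Surjective ((cokernel.π f).app X).hom :=
  (AddCommGrpCat.epi_iff_surjective _).1 inferInstance

theorem ker_cokernel_π_app_le_range (f : F ⟶ G) (X : C) :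
    ((cokernel.π f).app X).hom.ker ≤ (f.app X).hom.range :=
  (ShortComplex.ab_exact_iff _).1
    ((ShortComplex.exact_cokernel f).map ((evaluation C AddCommGrpCat.{u}).obj X))

end AddCommGrpValued

section HomologyZero

variable (C : Type*) [Category* C] [HasZeroMorphisms C] [CategoryWithHomology C]

/-- The quotient map from `0`-chains to `H_0`, natural in the chain complex. -/
def homologyZeroπ : HomologicalComplex.eval C (ComplexShape.down ℕ) 0 ⟶
    HomologicalComplex.homologyFunctor C (ComplexShape.down ℕ) 0 where
  app K := K.pOpcycles 0 ≫ (ChainComplex.isoHomologyι₀ K).inv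
  naturality K L f := by
    change f.f 0 ≫ L.pOpcycles 0 ≫ (ChainComplex.isoHomologyι₀ L).inv =
      (K.pOpcycles 0 ≫ (ChainComplex.isoHomologyι₀ K).inv) ≫ HomologicalComplex.homologyMap f 0
    simp

instance (K : ChainComplex C ℕ) : Epi ((homologyZeroπ C).app K) :=
  inferInstanceAs (Epi (K.pOpcycles 0 ≫ K.isoHomologyι₀.inv))

end HomologyZero

namespace FI

/-- The isomorphism of `FI` given by a bijection. -/
def isoOfEquiv {S T : FI} (e : S.carrier ≃ T.carrier) : S ≅ T where
  hom := e.toEmbedding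
  inv := e.symm.toEmbedding
  hom_inv_id := Function.Embedding.ext e.symm_apply_apply
  inv_hom_id := Function.Embedding.ext e.apply_symm_apply

theorem emb_iso_bijective {S T : FI} (e : S ≅ T) : Function.Bijective (emb e.hom) :=
  ⟨(emb e.hom).injective, fun t => ⟨emb e.inv t, congr(emb $(e.inv_hom_id) t)⟩⟩

theorem exists_iso_std (S : FI) : ∃ n, Nonempty (std n ≅ S) :=
  ⟨Nat.card S.carrier, ⟨isoOfEquiv (Finite.equivFin S.carrier).symm⟩⟩

theorem exists_addPoint_iso (T : FI) (a : T.carrier) :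
    ∃ (S : FI) (e : addPoint.obj S ≅ T), emb e.hom (Sum.inl 0) = a := by
  classical
  let e : Fin 1 ⊕ {t // t ≠ a} ≃ T.carrier :=
    ((Equiv.ofUnique (Fin 1) {t // t = a}).sumCongr (Equiv.refl _)).trans (Equiv.sumCompl (· = a))
  exact ⟨⟨{t // t ≠ a}⟩, isoOfEquiv e, rfl⟩

theorem card_addPoint (S : FI) : Nat.card (addPoint.obj S).carrier = Nat.card S.carrier + 1 := by
  change Nat.card (Fin 1 ⊕ S.carrier) = _
  rw [Nat.card_sum, Nat.card_fin, add_comm]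

end FI

namespace FIMod

/-- The subgroup of `M_T` generated by the images of the maps `M_g`, for all injections `g : S → T`
whose image does not contain `A`. The quotient of `M_T` by it is the cross effect of `M` at the
points of `A`. -/
def noncovering (M : FIMod.{u}) {T : FI} (A : Set T.carrier) : AddSubgroup (M.obj T) :=
  ⨆ (S : FI) (g : S ⟶ T) (_ : ¬ A ⊆ Set.range (FI.emb g)), (M.map g).hom.range

section noncovering

variable {M : FIMod.{u}} {S T : FI}

theorem noncovering_le_iff {A : Set T.carrier} {H : AddSubgroup (M.obj T)} :
    noncovering M A ≤ H ↔
      ∀ (S : FI) (g : S ⟶ T), ¬ A ⊆ Set.range (FI.emb g) → (M.map g).hom.range ≤ H := by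
  simp only [noncovering, iSup_le_iff]

theorem range_map_le_noncovering {A : Set T.carrier} (g : S ⟶ T)
    (hg : ¬ A ⊆ Set.range (FI.emb g)) : (M.map g).hom.range ≤ noncovering M A :=
  noncovering_le_iff.1 le_rfl S g hg

theorem noncovering_preimage_le_comap (f : S ⟶ T) (A : Set T.carrier) :
    noncovering M (FI.emb f ⁻¹' A) ≤ (noncovering M A).comap (M.map f).hom := by
  refine noncovering_le_iff.2 fun R g hg => ?_
  rintro _ ⟨z, rfl⟩
  obtain ⟨s, hsA, hsg⟩ := Set.not_subset.1 hg
  refine range_map_le_noncovering (g ≫ f) (fun hA => hsg ?_) ⟨z, M.map_comp_apply g f z⟩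
  obtain ⟨r, hr⟩ := hA hsA
  exact ⟨r, (FI.emb f).injective hr⟩

theorem noncovering_eq_top_of_iso (e : S ≅ T) {A : Set T.carrier}
    (h : noncovering M (FI.emb e.hom ⁻¹' A) = ⊤) : noncovering M A = ⊤ := by
  refine (AddSubgroup.eq_top_iff' _).2 fun y => ?_
  obtain ⟨x, rfl⟩ := map_hom_surjective_of_isIso (F := M) e.hom y
  exact noncovering_preimage_le_comap e.hom A (h ▸ AddSubgroup.mem_top x)

theorem not_subset_range_inclAddPoint {A : Set (FI.addPoint.obj S).carrier} (hA : Sum.inl 0 ∈ A) :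
    ¬ A ⊆ Set.range (FI.emb (FI.inclAddPoint.app S)) := fun h => by
  obtain ⟨s, hs⟩ := h hA
  exact Sum.inr_ne_inl hs

theorem not_subset_range_addPoint_map {g : S ⟶ T} {A : Set (FI.addPoint.obj T).carrier}
    (hg : ¬ Sum.inr ⁻¹' A ⊆ Set.range (FI.emb g)) :
    ¬ A ⊆ Set.range (FI.emb (FI.addPoint.map g)) := fun h => hg fun t ht => by
  obtain ⟨s | s, hs⟩ := h ht
  · exact absurd hs Sum.inl_ne_inr
  · exact ⟨s, Sum.inr_injective hs⟩

theorem noncovering_addPoint_eq_top {A : Set (FI.addPoint.obj S).carrier} (hA : Sum.inl 0 ∈ A)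
    (h : noncovering (cokernel (toShift M)) (T := S) (Sum.inr ⁻¹' A) = ⊤) :
    noncovering M A = ⊤ := by
  let π : M.obj (FI.addPoint.obj S) →+ (cokernel (toShift M)).obj S :=
    ((cokernel.π (toShift M)).app S).hom
  have ker_le : π.ker ≤ noncovering M A :=
    (ker_cokernel_π_app_le_range (toShift M) S).trans
      (range_map_le_noncovering (FI.inclAddPoint.app S) (not_subset_range_inclAddPoint hA))
  have map_eq_top : (noncovering M A).map π = ⊤ := by
    rw [eq_top_iff, ← h, noncovering_le_iff]
    rintro R g hg _ ⟨w, rfl⟩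
    obtain ⟨z, rfl⟩ := cokernel_π_app_surjective (toShift M) R w
    exact ⟨(M.map (FI.addPoint.map g)).hom z,
      range_map_le_noncovering _ (not_subset_range_addPoint_map hg) ⟨z, rfl⟩,
      congr($((cokernel.π (toShift M)).naturality g).hom z)⟩
  rw [← AddSubgroup.comap_map_eq_self ker_le, map_eq_top, AddSubgroup.comap_top]

end noncovering

/-- For all sufficiently large `T`, the cross effects of `M` at `ℓ` or more points of `T` vanish. -/
def VanishingCrossEffects (M : FIMod.{u}) (ℓ : ℕ) : Prop :=
  ∃ N : ℕ, ∀ (T : FI) (A : Set T.carrier), N ≤ Nat.card T.carrier → ℓ ≤ A.ncard →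
    noncovering M A = ⊤

theorem VanishingCrossEffects.mono {M : FIMod.{u}} {k ℓ : ℕ} (h : VanishingCrossEffects M k)
    (hkl : k ≤ ℓ) : VanishingCrossEffects M ℓ :=
  h.imp fun _ hN T A hT hA => hN T A hT (hkl.trans hA)

theorem vanishingCrossEffects_succ_of_addPoint {M : FIMod.{u}} {ℓ N : ℕ}
    (h : ∀ (S : FI) (A : Set (FI.addPoint.obj S).carrier), N ≤ Nat.card S.carrier →
      Sum.inl 0 ∈ A → ℓ + 1 ≤ A.ncard → noncovering M A = ⊤) :
    VanishingCrossEffects M (ℓ + 1) := by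
  refine ⟨N + 1, fun T A hT hA => ?_⟩
  obtain ⟨a, ha⟩ : A.Nonempty := Set.nonempty_of_ncard_ne_zero (by lia)
  obtain ⟨S, e, he⟩ := FI.exists_addPoint_iso T a
  have hbij := FI.emb_iso_bijective e
  refine noncovering_eq_top_of_iso e (h S _ ?_ (he ▸ ha : FI.emb e.hom (Sum.inl 0) ∈ A) ?_)
  · have := Nat.card_eq_of_bijective _ hbij
    rw [FI.card_addPoint] at this
    lia
  · rwa [Set.ncard_preimage_of_injective_subset_range hbij.1
      (hbij.2.range_eq ▸ Set.subset_univ A)]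

theorem VanishingCrossEffects.of_cokernel_toShift {M : FIMod.{u}} {ℓ : ℕ}
    (h : VanishingCrossEffects (cokernel (toShift M)) ℓ) : VanishingCrossEffects M (ℓ + 1) := by
  obtain ⟨N, hN⟩ := h
  refine vanishingCrossEffects_succ_of_addPoint (N := N) fun S A hS h0 hA =>
    noncovering_addPoint_eq_top h0 (hN S _ hS ?_)
  exact Nat.le_of_succ_le_succ (hA.trans (ncard_le_ncard_preimage_inr_add_one A))

theorem EventuallyConstant.vanishingCrossEffects {M : FIMod.{u}} (h : EventuallyConstant M) :
    VanishingCrossEffects M 1 := by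
  obtain ⟨N, hN⟩ := h
  refine vanishingCrossEffects_succ_of_addPoint (N := N) fun S A hS h0 _ => top_le_iff.1 ?_
  have : IsIso (M.map (FI.inclAddPoint.app S)) := hN _ _ _ hS
  rw [← AddMonoidHom.range_eq_top_of_surjective _
    (map_hom_surjective_of_isIso (F := M) (FI.inclAddPoint.app S))]
  exact range_map_le_noncovering _ (not_subset_range_inclAddPoint h0)

theorem PolynomialDegreeLE.vanishingCrossEffects {d : ℕ} {M : FIMod.{u}}
    (h : PolynomialDegreeLE d M) : VanishingCrossEffects M (d + 1) := by
  induction d generalizing M with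
  | zero => exact EventuallyConstant.vanishingCrossEffects h
  | succ d ih => exact (ih h).of_cokernel_toShift

section tensor

variable {M : FIMod.{u}} {N : FIopMod.{v}}

/-- The class of a pure tensor in `M ⊗_FI N`, as a biadditive map. -/
def tensorMk (M : FIMod.{u}) (N : FIopMod.{v}) (n : ℕ) :
    M.obj (FI.std n) →+ N.obj (.op (FI.std n)) →+ tensor M N :=
  AddMonoidHom.mk' (fun y => (QuotientAddGroup.mk' (tensorRelations M N)).comp
    ((DirectSum.of (fun n => M.obj (FI.std n) ⊗[ℤ] N.obj (.op (FI.std n))) n).comp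
      (TensorProduct.mk ℤ _ _ y).toAddMonoidHom)) fun y y' => by
    ext x
    simp

theorem tensorMk_map {m n : ℕ} (f : FI.std m ⟶ FI.std n) (y : M.obj (FI.std m))
    (x : N.obj (.op (FI.std n))) :
    tensorMk M N n ((M.map f).hom y) x = tensorMk M N m y ((N.map f.op).hom x) :=
  sub_eq_zero.1 ((QuotientAddGroup.eq_zero_iff _).2
    (AddSubgroup.subset_closure ⟨m, n, f, y, x, rfl⟩))

theorem subsingleton_tensor_of_tensorMk_eq_zero (h : ∀ n y x, tensorMk M N n y x = 0) :
    Subsingleton (tensor M N) := by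
  refine subsingleton_of_forall_eq 0 fun t => ?_
  induction t using QuotientAddGroup.induction_on with | H t => ?_
  induction t using DirectSum.induction_on with
  | zero => rfl
  | add a b ha hb => rw [QuotientAddGroup.mk_add, ha, hb, add_zero]
  | of n t =>
    induction t using TensorProduct.induction_on with
    | zero => rw [map_zero]; rfl
    | add a b ha hb => rw [map_add, QuotientAddGroup.mk_add, ha, hb, add_zero]
    | tmul y x => exact h n y x

theorem tensorMk_map_eq_zero {S : FI} {n : ℕ} (g : S ⟶ FI.std n) (z : M.obj S)
    {x : N.obj (.op (FI.std n))} (hx : (N.map g.op).hom x = 0) :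
    tensorMk M N n ((M.map g).hom z) x = 0 := by
  obtain ⟨m, ⟨e⟩⟩ := FI.exists_iso_std S
  obtain ⟨z, rfl⟩ := map_hom_surjective_of_isIso (F := M) e.hom z
  have hx' : (N.map (e.hom ≫ g).op).hom x = 0 := by
    rw [op_comp, N.map_comp, AddCommGrpCat.hom_comp, AddMonoidHom.comp_apply, hx, map_zero]
  rw [← M.map_comp_apply, tensorMk_map, hx', map_zero]

theorem tensorMk_eq_zero_of_mem_noncovering {n : ℕ} {A : Set (FI.std n).carrier}
    {y : M.obj (FI.std n)} (hy : y ∈ noncovering M A) {x : N.obj (.op (FI.std n))}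
    (hx : ∀ (S : FI) (g : S ⟶ FI.std n), ¬ A ⊆ Set.range (FI.emb g) → (N.map g.op).hom x = 0) :
    tensorMk M N n y x = 0 := by
  suffices h : noncovering M A ≤ ((tensorMk M N n).flip x).ker from h hy
  refine noncovering_le_iff.2 fun S g hg => ?_
  rintro _ ⟨z, rfl⟩
  exact tensorMk_map_eq_zero g z (hx S g hg)

end tensor

end FIMod

namespace TailInvariant

/-- The singular chain complex of a space with integer coefficients. -/
abbrev singularChains : TopCat.{0} ⥤ ChainComplex AddCommGrpCat.{0} ℕ :=
  (AlgebraicTopology.singularChainComplexFunctor AddCommGrpCat.{0}).obj (AddCommGrpCat.of ℤ)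

/-- The quotient map from singular `0`-chains of `X` to `H_0(X, A)`, natural in the pair. -/
def relativeHomologyZeroπ :
    Arrow.rightFunc ⋙ singularChains ⋙ HomologicalComplex.eval _ _ 0 ⟶ relativeHomology 0 :=
  Functor.whiskerLeft singularChains.mapArrow
      (Functor.whiskerRight (coker.π _) (HomologicalComplex.eval _ _ 0)) ≫
    Functor.whiskerLeft relativeChains (homologyZeroπ AddCommGrpCat.{0})

instance (P : Arrow TopCat.{0}) : Epi (relativeHomologyZeroπ.app P) := by
  have hπ : Epi ((cokernel.π (singularChains.map P.hom)).f 0) := inferInstance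
  exact epi_comp' hπ (inferInstanceAs (Epi ((homologyZeroπ _).app (relativeChains.obj P))))

theorem map_hom_comp_relativeHomologyZeroπ (P : Arrow TopCat.{0}) :
    (singularChains.map P.hom).f 0 ≫ relativeHomologyZeroπ.app P = 0 := by
  have h := congr_arg (fun k => HomologicalComplex.Hom.f k 0)
    (cokernel.condition (singularChains.map P.hom))
  exact (Category.assoc _ _ _).symm.trans ((congrArg (· ≫ _) h).trans zero_comp)

/-- The singular `0`-chain of a point. -/
def pointChain {X : TopCat.{0}} (x : X) : (singularChains.obj X).X 0 :=
  ((TopCat.toSSet.obj X).ιChainComplex (R := AddCommGrpCat.of ℤ)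
    (TopCat.toSSetObj₀Equiv.symm x)).hom (1 : ℤ)

theorem map_pointChain {X Y : TopCat.{0}} (f : X ⟶ Y) (x : X) :
    ((singularChains.map f).f 0).hom (pointChain x) = pointChain (f x) :=
  congr(($(SSet.ι_chainComplexMap_f _ _ (TopCat.toSSet.map f) (AddCommGrpCat.of ℤ)
    (TopCat.toSSetObj₀Equiv.symm x))).hom (1 : ℤ))

theorem closure_range_pointChain (X : TopCat.{0}) :
    AddSubgroup.closure (Set.range (pointChain (X := X))) = ⊤ := by
  set H := AddSubgroup.closure (Set.range (pointChain (X := X)))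
  have mk_eq_zero : AddCommGrpCat.ofHom (QuotientAddGroup.mk' H) = 0 := by
    refine SSet.chainComplex_hom_ext fun σ => ?_
    obtain ⟨x, rfl⟩ := TopCat.toSSetObj₀Equiv.symm.surjective σ
    ext
    exact (QuotientAddGroup.eq_zero_iff (pointChain x)).2
      (AddSubgroup.subset_closure (Set.mem_range_self x))
  rw [← QuotientAddGroup.ker_mk' H, AddMonoidHom.ker_eq_top_iff]
  exact congr($(mk_eq_zero).hom)

/-- The class of a point of `X` in `H_0(X, A)`. -/
def pointClass (P : Arrow TopCat.{0}) (x : P.right) : (relativeHomology 0).obj P :=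
  (relativeHomologyZeroπ.app P).hom (pointChain x)

theorem map_pointClass {P Q : Arrow TopCat.{0}} (f : P ⟶ Q) (x : P.right) :
    ((relativeHomology 0).map f).hom (pointClass P x) = pointClass Q (f.right x) :=
  congr(($(relativeHomologyZeroπ.naturality f)).hom (pointChain x)).symm.trans
    congr((relativeHomologyZeroπ.app Q).hom $(map_pointChain f.right x))

theorem pointClass_hom (P : Arrow TopCat.{0}) (x : P.left) : pointClass P (P.hom x) = 0 :=
  congr((relativeHomologyZeroπ.app P).hom $(map_pointChain P.hom x)).symm.trans
    congr(($(map_hom_comp_relativeHomologyZeroπ P)).hom (pointChain x))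

theorem closure_range_pointClass (P : Arrow TopCat.{0}) :
    AddSubgroup.closure (Set.range (pointClass P)) = ⊤ := by
  have hπ : Function.Surjective (relativeHomologyZeroπ.app P).hom :=
    (AddCommGrpCat.epi_iff_surjective _).1 inferInstance
  calc AddSubgroup.closure (Set.range (pointClass P))
      = AddSubgroup.closure ((relativeHomologyZeroπ.app P).hom '' Set.range pointChain) :=
        congrArg _ (Set.range_comp _ _)
    _ = (AddSubgroup.closure (Set.range pointChain)).map (relativeHomologyZeroπ.app P).hom :=
        (AddMonoidHom.map_closure _ _).symm
    _ = AddSubgroup.map (relativeHomologyZeroπ.app P).hom ⊤ :=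
        congrArg _ (closure_range_pointChain P.right)
    _ = ⊤ := AddSubgroup.map_top_of_surjective _ hπ

theorem relativeHomology_zero_map_surjective {P Q : Arrow TopCat.{0}} (f : P ⟶ Q)
    (hf : Function.Surjective f.right) : Function.Surjective ((relativeHomology 0).map f).hom := by
  rw [← AddMonoidHom.range_eq_top, eq_top_iff, ← closure_range_pointClass Q,
    AddSubgroup.closure_le]
  rintro _ ⟨y, rfl⟩
  obtain ⟨x, rfl⟩ := hf y
  exact ⟨pointClass P x, map_pointClass f x⟩

variable {ℓ : ℕ} {S T : FI}

theorem restrictX_surjective (f : S ⟶ T) : Function.Surjective (restrictX ℓ f) := fun φ => by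
  obtain ⟨ψ, hψ⟩ := exists_embedding_trans_eq (FI.emb f) ⟨φ.1, φ.2⟩
  exact ⟨⟨ψ, ψ.injective⟩, Subtype.ext congr(⇑$hψ)⟩

theorem Xi_map_surjective (f : S ⟶ T) : Function.Surjective ((Xi ℓ).map f.op).hom :=
  relativeHomology_zero_map_surjective ((pair ℓ).map f.op) (restrictX_surjective f)

/-- The class of an injection `S → [ℓ] ⊔ ℝ` in `Ξ(ℓ)_S`. -/
def xiClass (φ : X ℓ S) : (Xi ℓ).obj (.op S) :=
  pointClass ((pair ℓ).obj (.op S)) φ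

theorem closure_range_xiClass :
    AddSubgroup.closure (Set.range (xiClass (ℓ := ℓ) (S := S))) = ⊤ :=
  closure_range_pointClass ((pair ℓ).obj (.op S))

theorem xiClass_eq_zero {φ : X ℓ S}
    (h : ¬ Set.range (Sum.inl : Fin ℓ → Fin ℓ ⊕ ℝ) ⊆ Set.range φ.1) : xiClass φ = 0 :=
  pointClass_hom ((pair ℓ).obj (.op S)) (⟨φ, h⟩ : A ℓ S)

theorem map_xiClass_eq_zero {φ : X ℓ T} {g : S ⟶ T}
    (hg : ¬ φ.1 ⁻¹' Set.range Sum.inl ⊆ Set.range (FI.emb g)) :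
    ((Xi ℓ).map g.op).hom (xiClass φ) = 0 := by
  refine (map_pointClass ((pair ℓ).map g.op) φ).trans (xiClass_eq_zero fun hsub => hg ?_)
  intro t ht
  obtain ⟨s, hs⟩ := hsub ht
  exact ⟨s, φ.2 hs⟩

theorem ncard_preimage_range_inl {φ : X ℓ S}
    (h : Set.range (Sum.inl : Fin ℓ → Fin ℓ ⊕ ℝ) ⊆ Set.range φ.1) :
    (φ.1 ⁻¹' Set.range Sum.inl).ncard = ℓ := by
  rw [Set.ncard_preimage_of_injective_subset_range φ.2 h, ← Nat.card_coe_set_eq,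
    Nat.card_range_of_injective Sum.inl_injective, Nat.card_fin]

theorem tensorMk_xiClass_eq_zero {M : FIMod.{u}} {n : ℕ}
    (hM : ∀ A : Set (FI.std n).carrier, ℓ ≤ A.ncard → FIMod.noncovering M A = ⊤)
    (y : M.obj (FI.std n)) (φ : X ℓ (FI.std n)) :
    FIMod.tensorMk M (Xi ℓ) n y (xiClass φ) = 0 := by
  by_cases hφ : Set.range (Sum.inl : Fin ℓ → Fin ℓ ⊕ ℝ) ⊆ Set.range φ.1
  · have hy : y ∈ FIMod.noncovering M (φ.1 ⁻¹' Set.range Sum.inl) :=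
      hM _ (ncard_preimage_range_inl hφ).ge ▸ AddSubgroup.mem_top y
    exact FIMod.tensorMk_eq_zero_of_mem_noncovering hy fun _ _ => map_xiClass_eq_zero
  · rw [xiClass_eq_zero hφ, map_zero]

theorem subsingleton_tensor_Xi {M : FIMod.{u}} (hM : FIMod.VanishingCrossEffects M ℓ) :
    Subsingleton (FIMod.tensor M (Xi ℓ)) := by
  obtain ⟨N, hN⟩ := hM
  refine FIMod.subsingleton_tensor_of_tensorMk_eq_zero fun n y x => ?_
  let f : FI.std n ⟶ FI.std (n + N) := (Fin.castAddEmb N : Fin n ↪ Fin (n + N))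
  obtain ⟨x, rfl⟩ := Xi_map_surjective f x
  rw [← FIMod.tensorMk_map]
  have hcard : N ≤ Nat.card (FI.std (n + N)).carrier :=
    (Nat.le_add_left N n).trans_eq (Nat.card_fin (n + N)).symm
  suffices h : (⊤ : AddSubgroup _) ≤ (FIMod.tensorMk M (Xi ℓ) _ ((M.map f).hom y)).ker from
    h (AddSubgroup.mem_top x)
  rw [← closure_range_xiClass, AddSubgroup.closure_le]
  rintro _ ⟨φ, rfl⟩
  exact tensorMk_xiClass_eq_zero (fun A => hN _ A hcard) _ φ

end TailInvariant

end

theorem mainTheorem10_general (M : FIMod.{u}) (d : ℕ) (hd : FIMod.PolynomialDegreeLE d M) (ℓ : ℕ)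
    (hℓ : d < ℓ) : Subsingleton (FIMod.tensor M (TailInvariant.Xi ℓ)) :=
  TailInvariant.subsingleton_tensor_Xi (hd.vanishingCrossEffects.mono hℓ)

theorem mainTheorem10 (M : FIMod.{u}) (hM : FIMod.PresentedInFiniteDegree M)
    (d : ℕ) (hd : FIMod.PolynomialDegreeLE d M) (ℓ : ℕ) (hℓ : d < ℓ) :
    Subsingleton (FIMod.tensor M (TailInvariant.Xi ℓ)) :=
  mainTheorem10_general M d hd ℓ hℓ
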